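/- Throughout, $\log$ is the logarithm to base $2$. Fix a universal machine $U$ (a partial recursive function of a binary program and a side input that simulates every such machine $T$, with programs longer by at most a constant depending on $T$), and let $C(x\mid y)=\min\{l(p): U(p,y)=x\}$ be the conditional Kolmogorov complexity with respect to $U$, where $l(p)$ is the length of $p$. A labeled graph $G$ on the nodes $\{1,\dots,n\}$ (simple, undirected) is encoded by the binary string $E(G)$ of length $\binom n2$ that lists, for the pairs $i<j$ in lexicographic order, whether $\{i,j\}$ is an edge; $G$ is called $\delta(n)$-random if $C(E(G)\mid n)\ge\binom n2-\delta(n)$. A labeled graph $H$ on $\{1,\dots,k\}$ occurs in $G$ as an ordered labeled subgraph if there are nodes $i_1<\dots<i_k$ of $G$ such that relabeling $i_1,\dots,i_k$ as $1,\dots,k$ turns the subgraph of $G$ induced on $\{i_1,\dots,i_k\}$ into $H$. Theorem. There is an $n_0$, depending only on $U$, such that the following holds for all real-valued functions $\delta$ and all $n\ge n_0$ with $\delta(n)<2^{\sqrt{\frac12\log n}}/(4\log n)$. If $G$ is a $\delta(n)$-random labeled graph on $n$ nodes, then every labeled graph $H$ on $k\le\sqrt{2\log n}$ nodes (in particular,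 on $k=\lfloor\sqrt{2\log n}\rfloor$ nodes) occurs in $G$ as an ordered labeled subgraph. -/

import Mathlib

namespace KolmogorovGraphs

/-- A machine `U` takes a program (a finite binary string) and a side input (a natural number,
equivalently a binary string) and outputs a binary string, if it halts. -/
abbrev Machine : Type := List Bool → ℕ → Part (List Bool)

/-- `U` is a universal machine: it is partial recursive, and every partial recursive machine `T`
is simulated by feeding to `U` instead of the program `p` the string `e p` (the pair `⟨i, p⟩` of an
index `i` of `T` and of `p`), which is longer than `p` by at most a constant depending on `T`. -/
def IsUniversal (U : Machine) : Prop :=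
  Partrec₂ U ∧
    ∀ T : Machine, Partrec₂ T →
      ∃ (e : List Bool → List Bool) (c : ℕ),
        ∀ p : List Bool, (e p).length ≤ p.length + c ∧ ∀ y : ℕ, U (e p) y = T p y

/-- The conditional (plain) Kolmogorov complexity `C(x | y)` with respect to the machine `U`: the
least length of a program `p` with `U(p, y) = x`. -/
noncomputable def condComplexity (U : Machine) (x : List Bool) (y : ℕ) : ℕ :=
  sInf {l : ℕ | ∃ p : List Bool, x ∈ U p y ∧ p.length = l}

open Classical in
/-- The standard encoding `E(G)` of a labeled graph on `n` nodes: the binary string listing, for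
the pairs `i < j` of nodes in lexicographic order, whether `{i, j}` is an edge. -/
noncomputable def edgeString {n : ℕ} (G : SimpleGraph (Fin n)) : List Bool :=
  (List.finRange n).flatMap fun i =>
    ((List.finRange n).filter fun j => decide (i < j)).map fun j => decide (G.Adj i j)

/-- A labeled graph `G` on `n` nodes is `δ`-random: `C(E(G) | n) ≥ (n choose 2) - δ`. -/
def IsRandom (U : Machine) (δ : ℝ) {n : ℕ} (G : SimpleGraph (Fin n)) : Prop :=
  (n.choose 2 : ℝ) - δ ≤ (condComplexity U (edgeString G) n : ℝ)

/-- `H`, on nodes `1, …, k`, occurs in `G` as an ordered labeled subgraph: there are nodes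
`i₁ < ⋯ < iₖ` of `G` such that relabeling them as `1, …, k` turns the subgraph of `G` they
induce into `H`. -/
def OccursIn {k n : ℕ} (H : SimpleGraph (Fin k)) (G : SimpleGraph (Fin n)) : Prop :=
  ∃ i : Fin k → Fin n, StrictMono i ∧ ∀ a b : Fin k, G.Adj (i a) (i b) ↔ H.Adj a b


/-- The machine that on the program `1ⁱ 0 p` runs the `i`-th partial recursive function on `p`. -/
def refMachine : Machine := fun q y =>
  ((Denumerable.ofNat Nat.Partrec.Code (q.findIdx fun b => !b)).eval
    (Encodable.encode (q.drop ((q.findIdx fun b => !b) + 1), y))).bind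
      fun m => (Part.ofOption (Encodable.decode m : Option (List Bool)))

/-- Universal machines exist. -/
theorem isUniversal_refMachine : IsUniversal refMachine := by
  have hidx : Computable (fun q : List Bool => q.findIdx fun b => !b) :=
    (Primrec.list_findIdx Primrec.id (Primrec.not.comp Primrec.snd).to₂).to_comp
  constructor
  · have h1 : Partrec fun q : List Bool × ℕ =>
        (Denumerable.ofNat Nat.Partrec.Code (q.1.findIdx fun b => !b)).eval
          (Encodable.encode (q.1.drop ((q.1.findIdx fun b => !b) + 1), q.2)) := by
      refine Nat.Partrec.Code.eval_part.comp
        ((Computable.ofNat _).comp (hidx.comp Computable.fst))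
        (Computable.encode.comp (Computable.pair ?_ Computable.snd))
      exact (Primrec.list_drop.to_comp).comp
        (Computable.succ.comp (hidx.comp Computable.fst)) Computable.fst
    exact h1.bind (Computable.decode.comp Computable.snd).ofOption.to₂
  · intro T hT
    obtain ⟨c, hc⟩ := Nat.Partrec.Code.exists_code.1 hT
    refine ⟨fun p => List.replicate (Encodable.encode c) true ++ false :: p,
      Encodable.encode c + 1, fun p => ⟨by simp; omega, fun y => ?_⟩⟩
    have hi : (List.replicate (Encodable.encode c) true ++ false :: p).findIdx (fun b => !b)
        = Encodable.encode c := by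
      induction Encodable.encode c with
      | zero => simp [List.findIdx_cons]
      | succ m ih => rw [List.replicate_succ, List.cons_append, List.findIdx_cons, ih]; rfl
    have hd : (List.replicate (Encodable.encode c) true ++ false :: p).drop
        (Encodable.encode c + 1) = p := by
      simp [List.drop_append]
    simp only [refMachine, hi, hd, Denumerable.ofNat_encode, hc, Encodable.encodek,
      Part.coe_some, Part.bind_some, Part.bind_map]
    simp

/-- The encoding of a graph on `n` nodes has length `n choose 2`. -/
theorem edgeString_length {n : ℕ} (G : SimpleGraph (Fin n)) :
    (edgeString G).length = n.choose 2 := by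
  have : ∀ i : Fin n,
      ((List.finRange n).filter fun j => decide (i < j)).length = (Finset.Ioi i).card := by
    intro i
    rw [← List.toFinset_card_of_nodup ((List.nodup_finRange n).filter _)]
    congr 1; ext; simp
  simp only [edgeString, List.length_flatMap, List.length_map, this, Fin.card_Ioi]
  rw [← Fin.sum_univ_def, Fin.sum_univ_eq_sum_range (fun i => n - 1 - i) n,
    Finset.sum_range_reflect (fun i => i) n, Finset.sum_range_id, Nat.choose_two_right]

/-- For a universal machine the minimum defining the complexity is over a nonempty set. -/
theorem condComplexity_attained {U : Machine} (hU : IsUniversal U) (x : List Bool) (y : ℕ) :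
    ∃ p : List Bool, x ∈ U p y ∧ p.length = condComplexity U x y := by
  refine Nat.sInf_mem (s := {l : ℕ | ∃ p : List Bool, x ∈ U p y ∧ p.length = l}) ?_
  obtain ⟨e, c, h⟩ := hU.2 (fun p _ => Part.some p) Computable.fst.partrec
  exact ⟨_, e x, by simp [(h x).2 y], rfl⟩

end KolmogorovGraphs

namespace KolmogorovGraphs

/-! The proof is by incompressibility. Cut the nodes into `n / k` consecutive blocks of `k` nodes.
Their edge positions are disjoint, so of the `2 ^ (n choose 2)` graphs at most a fraction `(1 - 2 ^
(-(k choose 2))) ^ (n / k)` avoids `H` on every block (`length_avoiding_mul_le`). Such a graph is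
determined by `k`, `H` and its index among them, which saves about `(n / k) / 2 ^ (k choose 2)` bits
at a cost of `k + (k choose 2) + O(1)`. Randomness therefore bounds the saving by `δ` plus this cost
(`exists_blocks_le`). With `s = √(2 log n)` and `k ≤ s`, the saving is at least `2 ^ (s / 2) / (2 *
s)`, while `δ < 2 ^ (s / 2) / (2 * s ^ 2)`: a contradiction for large `n`. -/

/-! ### Edge encodings and blocks of nodes -/

/-- The pairs `i < j` of numbers below `n`, in lexicographic order. -/
def pairs (n : ℕ) : List (ℕ × ℕ) :=
  (List.range n).flatMap fun i => (List.range n).flatMap fun j => if i < j then [(i, j)] else []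

theorem mem_pairs {n : ℕ} {p : ℕ × ℕ} : p ∈ pairs n ↔ p.1 < p.2 ∧ p.2 < n := by
  obtain ⟨a, b⟩ := p
  simp only [pairs, List.mem_flatMap, List.mem_range, List.mem_ite_nil_right, List.mem_singleton,
    Prod.mk.injEq]
  constructor
  · rintro ⟨i, hi, j, hj, hij, rfl, rfl⟩
    exact ⟨hij, hj⟩
  · rintro ⟨h1, h2⟩
    exact ⟨a, h1.trans h2, b, h2, h1, rfl, rfl⟩

/-- Adjacency of two nodes given as natural numbers. -/
def natAdj {n : ℕ} (G : SimpleGraph (Fin n)) (p : ℕ × ℕ) : Prop :=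
  ∃ (h1 : p.1 < n) (h2 : p.2 < n), G.Adj ⟨p.1, h1⟩ ⟨p.2, h2⟩

theorem natAdj_val {n : ℕ} (G : SimpleGraph (Fin n)) (i j : Fin n) :
    natAdj G (i.val, j.val) ↔ G.Adj i j :=
  ⟨fun ⟨_, _, h⟩ => h, fun h => ⟨i.2, j.2, h⟩⟩

-- Indexing by natural numbers instead of `Fin n` makes positions in the encoding computable
-- uniformly in `n`.
open Classical in
theorem edgeString_eq_map {n : ℕ} (G : SimpleGraph (Fin n)) :
    edgeString G = (pairs n).map fun p => decide (natAdj G p) := by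
  have hfilter : ∀ (l : List (Fin n)) (i : Fin n),
      (l.filter fun j => decide (i < j)).map (fun j => decide (G.Adj i j)) =
        l.flatMap fun j => if i < j then [decide (natAdj G (i.val, j.val))] else [] := by
    intro l i
    induction l with
    | nil => rfl
    | cons a l ih =>
      by_cases h : i < a <;> simp [h, ih, natAdj_val]
  simp only [edgeString, pairs, hfilter, List.map_flatMap]
  rw [← List.map_coe_finRange_eq_range, List.flatMap_map]
  congr 1
  funext i
  rw [List.flatMap_map]
  congr 1
  funext j
  by_cases h : i < j
  · simp [h]
  · simp [h]

theorem pairs_length (n : ℕ) : (pairs n).length = n.choose 2 := by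
  classical
  rw [← edgeString_length (⊥ : SimpleGraph (Fin n)), edgeString_eq_map, List.length_map]

open Classical in
theorem edgeString_getD_idxOf {n : ℕ} (G : SimpleGraph (Fin n)) {p : ℕ × ℕ} (hp : p ∈ pairs n) :
    (edgeString G).getD ((pairs n).idxOf p) false = decide (natAdj G p) := by
  have h := List.idxOf_lt_length_of_mem hp
  rw [edgeString_eq_map, List.getD_eq_getElem _ _ (by simpa using h), List.getElem_map,
    List.getElem_idxOf]

/-- The encodings, read off from the encoding `x` of a graph on `n` nodes, of the subgraphs on the
consecutive blocks of `k` nodes. -/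
def blocks (k n : ℕ) (x : List Bool) : List (List Bool) :=
  (List.range (n / k)).map fun i =>
    (pairs k).map fun p => x.getD ((pairs n).idxOf (i * k + p.1, i * k + p.2)) false

/-- The pairs of nodes in a block are pairs of nodes. -/
theorem block_mem_pairs {k n i : ℕ} (hi : i < n / k) {p : ℕ × ℕ} (hp : p ∈ pairs k) :
    (i * k + p.1, i * k + p.2) ∈ pairs n := by
  rw [mem_pairs] at hp ⊢
  have h1 : (i + 1) * k ≤ n := (Nat.mul_le_mul_right k hi).trans (Nat.div_mul_le_self n k)
  rw [add_mul] at h1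
  exact ⟨by omega, by dsimp only; omega⟩

theorem occursIn_of_mem_blocks {k n : ℕ} {H : SimpleGraph (Fin k)} {G : SimpleGraph (Fin n)}
    (h : edgeString H ∈ blocks k n (edgeString G)) : OccursIn H G := by
  classical
  simp only [blocks, List.mem_map, List.mem_range] at h
  obtain ⟨i, hi, h⟩ := h
  rw [edgeString_eq_map H, List.map_inj_left] at h
  have hlt : ∀ a : Fin k, i * k + a < n := fun a => by
    have h1 : (i + 1) * k ≤ n := (Nat.mul_le_mul_right k hi).trans (Nat.div_mul_le_self n k)
    rw [add_mul] at h1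
    omega
  have key : ∀ a b : Fin k, a < b →
      (G.Adj ⟨i * k + a, hlt a⟩ ⟨i * k + b, hlt b⟩ ↔ H.Adj a b) := by
    intro a b hab
    have hp : (a.val, b.val) ∈ pairs k := mem_pairs.2 ⟨hab, b.2⟩
    have h2 := h _ hp
    rw [edgeString_getD_idxOf G (block_mem_pairs hi hp), decide_eq_decide] at h2
    rw [← natAdj_val H, ← h2, ← natAdj_val G]
  refine ⟨fun a => ⟨i * k + a, hlt a⟩, fun a b hab => ?_, fun a b => ?_⟩
  · simpa using hab
  · rcases lt_trichotomy a b with hab | rfl | hab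
    · exact key a b hab
    · simp
    · rw [G.adj_comm, H.adj_comm, key b a hab]

/-! ### Listing the encodings that avoid a pattern -/

/-- All binary strings of a given length. -/
def allStrings (l : ℕ) : List (List Bool) :=
  Nat.rec [[]] (fun _ L => L.map (List.cons false) ++ L.map (List.cons true)) l

theorem mem_allStrings {l : ℕ} {x : List Bool} : x ∈ allStrings l ↔ x.length = l := by
  induction l generalizing x with
  | zero => simp [allStrings]
  | succ l ih =>
    change x ∈ (allStrings l).map (List.cons false) ++ (allStrings l).map (List.cons true) ↔ _
    cases x with
    | nil => simp
    | cons b x => cases b <;> simp [ih]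

theorem allStrings_length (l : ℕ) : (allStrings l).length = 2 ^ l := by
  induction l with
  | zero => rfl
  | succ l ih =>
    change ((allStrings l).map (List.cons false) ++ (allStrings l).map (List.cons true)).length = _
    simp [ih, pow_succ]; ring

theorem allStrings_nodup (l : ℕ) : (allStrings l).Nodup := by
  induction l with
  | zero => simp [allStrings]
  | succ l ih =>
    change ((allStrings l).map (List.cons false) ++ (allStrings l).map (List.cons true)).Nodup
    refine List.Nodup.append (ih.map (List.cons_injective)) (ih.map (List.cons_injective)) ?_
    intro x h1 h2
    simp only [List.mem_map] at h1 h2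
    obtain ⟨_, _, rfl⟩ := h1
    obtain ⟨_, _, h⟩ := h2
    simp at h

/-- The strings encoding graphs on `n` nodes, none of whose blocks of `k` nodes is encoded
by `h`. -/
def avoiding (k n : ℕ) (h : List Bool) : List (List Bool) :=
  (allStrings (pairs n).length).flatMap fun x =>
    -- Membership is spelled as a bounded existential, the form handled by
    -- `PrimrecRel.exists_mem_list`.
    if ∃ y ∈ blocks k n x, y = h then [] else [x]

theorem mem_avoiding {k n : ℕ} {h x : List Bool} :
    x ∈ avoiding k n h ↔ x.length = (pairs n).length ∧ h ∉ blocks k n x := by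
  simp only [avoiding, List.mem_flatMap, mem_allStrings, exists_eq_right, List.mem_ite_nil_left,
    List.mem_singleton]
  constructor
  · rintro ⟨a, ha, h1, rfl⟩
    exact ⟨ha, h1⟩
  · rintro ⟨ha, h1⟩
    exact ⟨x, ha, h1, rfl⟩

theorem avoiding_eq_filter (k n : ℕ) (h : List Bool) :
    avoiding k n h =
      (allStrings (pairs n).length).filter fun x => decide (h ∉ blocks k n x) := by
  unfold avoiding
  induction allStrings (pairs n).length with
  | nil => rfl
  | cons a l ih =>
    by_cases h1 : h ∈ blocks k n a <;> simp_all

theorem avoiding_nodup (k n : ℕ) (h : List Bool) : (avoiding k n h).Nodup := by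
  rw [avoiding_eq_filter]
  exact (allStrings_nodup _).filter _

/-! ### Computability of the list -/

theorem primrec_pairs : Primrec pairs := by
  have hc : PrimrecPred fun q : (ℕ × ℕ) × ℕ => q.1.2 < q.2 :=
    Primrec.nat_lt.comp (Primrec.snd.comp Primrec.fst) Primrec.snd
  refine Primrec.list_flatMap Primrec.list_range (Primrec.list_flatMap
    (Primrec.list_range.comp Primrec.fst) (Primrec.ite hc
      (Primrec.list_cons.comp (Primrec.pair (Primrec.snd.comp Primrec.fst) Primrec.snd)
        (Primrec.const [])) (Primrec.const [])))

theorem primrec_allStrings : Primrec allStrings := by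
  refine Primrec.nat_rec₁ [[]] ?_
  have hL : Primrec fun q : ℕ × List (List Bool) => q.2 := Primrec.snd
  exact Primrec.list_append.comp
    (Primrec.list_map hL (Primrec.list_cons.comp (Primrec.const false) Primrec.snd))
    (Primrec.list_map hL (Primrec.list_cons.comp (Primrec.const true) Primrec.snd))

/-- All lawful `BEq` instances coincide, so the one inferred for pairs or strings may be replaced by
the one from decidable equality. -/
theorem primrec_idxOf {α : Type*} [Primcodable α] [i : BEq α] [LawfulBEq α] :
    Primrec₂ fun (a : α) (l : List α) => l.idxOf a := by
  classical
  have hi : i = instBEqOfDecidableEq := lawful_beq_subsingleton _ _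
  subst hi
  exact Primrec.list_idxOf

theorem primrec_blocks : Primrec fun q : (ℕ × ℕ) × List Bool => blocks q.1.1 q.1.2 q.2 := by
  have hk : Primrec fun q : (ℕ × ℕ) × List Bool => q.1.1 := Primrec.fst.comp Primrec.fst
  have hn : Primrec fun q : (ℕ × ℕ) × List Bool => q.1.2 := Primrec.snd.comp Primrec.fst
  refine Primrec.list_map (Primrec.list_range.comp (Primrec.nat_div.comp hn hk)) ?_
  refine Primrec.list_map (primrec_pairs.comp (hk.comp Primrec.fst)) ?_
  have hq : Primrec fun r : (((ℕ × ℕ) × List Bool) × ℕ) × (ℕ × ℕ) => r.1.1 :=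
    Primrec.fst.comp Primrec.fst
  have hik : Primrec fun r : (((ℕ × ℕ) × List Bool) × ℕ) × (ℕ × ℕ) => r.1.2 * r.1.1.1.1 :=
    Primrec.nat_mul.comp (Primrec.snd.comp Primrec.fst) (hk.comp hq)
  exact (Primrec.list_getD false).comp (Primrec.snd.comp hq)
    (primrec_idxOf.comp
      (Primrec.pair (Primrec.nat_add.comp hik (Primrec.fst.comp Primrec.snd))
        (Primrec.nat_add.comp hik (Primrec.snd.comp Primrec.snd)))
      (primrec_pairs.comp (hn.comp hq)))

theorem primrec_avoiding : Primrec fun q : (ℕ × ℕ) × List Bool => avoiding q.1.1 q.1.2 q.2 := by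
  refine Primrec.list_flatMap
    (primrec_allStrings.comp (Primrec.list_length.comp (primrec_pairs.comp
      (Primrec.snd.comp Primrec.fst)))) ?_
  refine Primrec.ite ?_ (Primrec.const [])
    (Primrec.list_cons.comp Primrec.snd (Primrec.const []))
  exact (PrimrecRel.exists_mem_list Primrec.eq).comp
    (primrec_blocks.comp (Primrec.pair (Primrec.fst.comp Primrec.fst) Primrec.snd))
    (Primrec.snd.comp Primrec.fst)

/-! ### Short descriptions of avoiding graphs -/

/-- The decoding of `1ᵏ 0 h r`, where `h` has length `k choose 2`, with the side input `n`: the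
member of `avoiding k n h` whose position is that of `r` among the strings of its length. -/
def decodeAvoiding (q : List Bool) (n : ℕ) : List Bool :=
  let k := q.findIdx fun b => !b
  let h := (q.drop (k + 1)).take (pairs k).length
  let r := (q.drop (k + 1)).drop (pairs k).length
  (avoiding k n h).getD ((allStrings r.length).idxOf r) []

theorem primrec_decodeAvoiding : Primrec₂ decodeAvoiding := by
  have hk : Primrec fun z : List Bool × ℕ => z.1.findIdx fun b => !b :=
    Primrec.list_findIdx Primrec.fst (Primrec.not.comp Primrec.snd).to₂
  have hd : Primrec fun z : List Bool × ℕ => z.1.drop ((z.1.findIdx fun b => !b) + 1) :=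
    Primrec.list_drop.comp (Primrec.succ.comp hk) Primrec.fst
  have hl : Primrec fun z : List Bool × ℕ => (pairs (z.1.findIdx fun b => !b)).length :=
    Primrec.list_length.comp (primrec_pairs.comp hk)
  have hh := Primrec.list_take.comp hl hd
  have hr := Primrec.list_drop.comp hl hd
  have ha := primrec_avoiding.comp (Primrec.pair (Primrec.pair hk Primrec.snd) hh)
  have hi := primrec_idxOf.comp hr (primrec_allStrings.comp (Primrec.list_length.comp hr))
  exact ((Primrec.list_getD []).comp ha hi).of_eq fun _ => rfl

theorem findIdx_replicate_true_append (k : ℕ) (l : List Bool) :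
    (List.replicate k true ++ false :: l).findIdx (fun b => !b) = k := by
  induction k with
  | zero => simp [List.findIdx_cons]
  | succ m ih => rw [List.replicate_succ, List.cons_append, List.findIdx_cons, ih]; rfl

theorem decodeAvoiding_code (k n : ℕ) {h : List Bool} (hh : h.length = (pairs k).length)
    (r : List Bool) :
    decodeAvoiding (List.replicate k true ++ false :: (h ++ r)) n =
      (avoiding k n h).getD ((allStrings r.length).idxOf r) [] := by
  have hd : (List.replicate k true ++ false :: (h ++ r)).drop (k + 1) = h ++ r := by
    simp [List.drop_append]
  simp only [decodeAvoiding, findIdx_replicate_true_append, hd, List.take_left' hh,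
    List.drop_left' hh]

theorem condComplexity_le_of_mem {U : Machine} {x p : List Bool} {y : ℕ} (h : x ∈ U p y) :
    condComplexity U x y ≤ p.length :=
  Nat.sInf_le ⟨p, h, rfl⟩

/-- A string in `avoiding k n h` is described by `k`, `h` and its position. -/
theorem exists_condComplexity_le {U : Machine} (hU : IsUniversal U) :
    ∃ c : ℕ, ∀ (k n : ℕ) (h x : List Bool), h.length = k.choose 2 → x ∈ avoiding k n h →
      condComplexity U x n ≤
        k + 1 + k.choose 2 + Nat.clog 2 (avoiding k n h).length + c := by
  obtain ⟨e, c, hc⟩ := hU.2 (fun q n => Part.some (decodeAvoiding q n))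
    primrec_decodeAvoiding.to_comp.partrec
  refine ⟨c, fun k n h x hh hx => ?_⟩
  set l := Nat.clog 2 (avoiding k n h).length
  have hpos := List.idxOf_lt_length_of_mem hx
  have hlt : (avoiding k n h).idxOf x < (allStrings l).length := by
    rw [allStrings_length]
    exact hpos.trans_le (Nat.le_pow_clog one_lt_two _)
  -- The index of `x`, written with `l` bits. Coming last in the program, it needs no delimiter.
  set r := (allStrings l)[(avoiding k n h).idxOf x]
  have hr : r.length = l := mem_allStrings.1 (List.getElem_mem hlt)
  have hidx : (allStrings r.length).idxOf r = (avoiding k n h).idxOf x := by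
    rw [hr]
    exact (allStrings_nodup l).idxOf_getElem _ hlt
  set p := List.replicate k true ++ false :: (h ++ r)
  have hdec : decodeAvoiding p n = x := by
    rw [decodeAvoiding_code k n (hh.trans (pairs_length k).symm) r, hidx,
      List.getD_eq_getElem _ _ hpos, List.getElem_idxOf]
  have hmem : x ∈ U (e p) n := by
    rw [(hc p).2 n, hdec]
    exact Part.mem_some x
  calc condComplexity U x n ≤ (e p).length := condComplexity_le_of_mem hmem
    _ ≤ p.length + c := (hc p).1
    _ = _ := by simp [p, hr, hh]; omega


/-! ### Counting avoiding graphs -/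

/-- Counting the binary functions on `τ` whose restrictions to the members of a family of disjoint
index sets all differ from a given pattern. -/
theorem card_avoiding_mul_le {ι κ τ : Type*} [Fintype ι] [Fintype κ] [Fintype τ]
    {e : κ × ι → τ} (he : Function.Injective e) (g : ι → Bool) :
    Nat.card {f : τ → Bool // ∀ i, (fun j => f (e (i, j))) ≠ g} *
        (2 ^ Fintype.card ι) ^ Fintype.card κ ≤
      2 ^ Fintype.card τ * (2 ^ Fintype.card ι - 1) ^ Fintype.card κ := by
  classical
  -- A function is determined by its restrictions to the index sets, each missing one pattern, and
  -- its values elsewhere.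
  let F : {f : τ → Bool // ∀ i, (fun j => f (e (i, j))) ≠ g} →
      (κ → {u : ι → Bool // u ≠ g}) × ({t : τ // t ∉ Set.range e} → Bool) :=
    fun f => (fun i => ⟨fun j => f.1 (e (i, j)), f.2 i⟩, fun t => f.1 t)
  have hF : Function.Injective F := by
    intro f f' h
    apply Subtype.ext
    funext t
    by_cases ht : t ∈ Set.range e
    · obtain ⟨⟨i, j⟩, rfl⟩ := ht
      exact congrFun (congrArg Subtype.val (congrFun (congrArg Prod.fst h) i)) j
    · exact congrFun (congrArg Prod.snd h) ⟨t, ht⟩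
  have h1 := Nat.card_le_card_of_injective F hF
  have h2 : Fintype.card {t : τ // t ∉ Set.range e} + Fintype.card κ * Fintype.card ι =
      Fintype.card τ := by
    rw [Fintype.card_subtype_compl, ← Fintype.card_prod,
      ← Set.card_range_of_injective he]
    exact Nat.sub_add_cancel (Fintype.card_subtype_le _)
  have h3 : Fintype.card {u : ι → Bool // u ≠ g} = 2 ^ Fintype.card ι - 1 := by
    rw [Fintype.card_subtype_compl]; simp
  rw [Nat.card_prod, Nat.card_fun, Nat.card_fun] at h1
  simp only [Nat.card_eq_fintype_card, h3, Fintype.card_bool] at h1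
  rw [Nat.card_eq_fintype_card]
  calc _ ≤ _ := Nat.mul_le_mul_right _ h1
    _ = _ := by rw [← h2, pow_add, mul_comm (Fintype.card κ), pow_mul]; ring

theorem length_avoiding_mul_le (k n : ℕ) {h : List Bool} (hh : h.length = k.choose 2) :
    (avoiding k n h).length * (2 ^ k.choose 2) ^ (n / k) ≤
      2 ^ n.choose 2 * (2 ^ k.choose 2 - 1) ^ (n / k) := by
  classical
  have hpos : ∀ (i : Fin (n / k)) (j : Fin (pairs k).length),
      (pairs n).idxOf (i * k + (pairs k)[j].1, i * k + (pairs k)[j].2) < (pairs n).length :=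
    fun i j => List.idxOf_lt_length_of_mem (block_mem_pairs i.2 (List.getElem_mem _))
  let e : Fin (n / k) × Fin (pairs k).length → Fin (pairs n).length := fun z => ⟨_, hpos z.1 z.2⟩
  have hnodup : (pairs k).Nodup := by
    unfold pairs
    refine List.nodup_flatMap.2 ⟨fun i _ => List.nodup_flatMap.2 ⟨fun j _ => ?_, ?_⟩, ?_⟩
    · split_ifs <;> simp
    · refine List.nodup_range.imp fun {a b} hab p h1 h2 => ?_
      simp only [List.mem_ite_nil_right, List.mem_singleton] at h1 h2
      exact hab (congrArg Prod.snd (h1.2.symm.trans h2.2))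
    · refine List.nodup_range.imp fun {a b} hab p h1 h2 => ?_
      simp only [List.mem_flatMap, List.mem_ite_nil_right, List.mem_singleton] at h1 h2
      obtain ⟨_, _, _, rfl⟩ := h1
      obtain ⟨_, _, _, h⟩ := h2
      exact hab (congrArg Prod.fst h)
  have he : Function.Injective e := by
    rintro ⟨i, j⟩ ⟨i', j'⟩ hij
    have hm := block_mem_pairs i.2 (List.getElem_mem (l := pairs k) j.2)
    have h1 := (List.idxOf_inj hm).1 (congrArg Fin.val hij)
    simp only [Prod.mk.injEq] at h1
    have hj := mem_pairs.1 (List.getElem_mem (l := pairs k) j.2)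
    have hj' := mem_pairs.1 (List.getElem_mem (l := pairs k) j'.2)
    have hk : 0 < k := by omega
    -- Dividing a node by `k` recovers its block, so distinct blocks share no edge position.
    have hi : i.val = i'.val := by
      have h2 : (i.val * k + (pairs k)[j.val].2) / k = (i'.val * k + (pairs k)[j'.val].2) / k :=
        congrArg (· / k) h1.2
      rwa [mul_comm, Nat.mul_add_div hk, mul_comm, Nat.mul_add_div hk, Nat.div_eq_of_lt hj.2,
        Nat.div_eq_of_lt hj'.2] at h2
    rw [hi] at h1
    have h3 : (pairs k)[j.val] = (pairs k)[j'.val] :=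
      Prod.ext (Nat.add_left_cancel h1.1) (Nat.add_left_cancel h1.2)
    exact Prod.ext (Fin.ext hi) (Fin.ext ((hnodup.getElem_inj_iff).1 h3))
  have hcount := card_avoiding_mul_le he fun j => h.getD j false
  simp only [Fintype.card_fin, pairs_length] at hcount
  refine le_trans (Nat.mul_le_mul_right _ ?_) hcount
  rw [← List.toFinset_card_of_nodup (avoiding_nodup k n h), ← Nat.card_eq_finsetCard]
  let F : (avoiding k n h).toFinset →
      {f : Fin (pairs n).length → Bool // ∀ i, (fun j => f (e (i, j))) ≠ fun j => h.getD j.val false} :=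
    fun x => ⟨fun t => x.1.getD t false, fun i hi => by
      obtain ⟨hx, hne⟩ := mem_avoiding.1 (List.mem_toFinset.1 x.2)
      refine hne (List.mem_map.2 ⟨i, List.mem_range.2 i.2, ?_⟩)
      refine List.ext_getElem (by rw [List.length_map, hh, pairs_length]) fun j h1 h2 => ?_
      have h3 := congrFun hi ⟨j, by simpa using h1⟩
      rw [List.getElem_map]
      exact h3.trans (List.getD_eq_getElem _ _ h2)⟩
  refine Nat.card_le_card_of_injective F fun x y hxy => Subtype.ext ?_
  obtain ⟨hx, -⟩ := mem_avoiding.1 (List.mem_toFinset.1 x.2)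
  obtain ⟨hy, -⟩ := mem_avoiding.1 (List.mem_toFinset.1 y.2)
  refine List.ext_getElem (hx.trans hy.symm) fun t h1 h2 => ?_
  have h3 := congrFun (congrArg Subtype.val hxy) ⟨t, hx ▸ h1⟩
  simpa only [F, List.getD_eq_getElem _ _ h1, List.getD_eq_getElem _ _ h2] using h3

/-- Follows from the count by `1 - t ≤ exp (-t)`; since `log 2 ≤ 1`, passing to base 2 only
increases the saving. -/
theorem logb_length_avoiding_le {k n : ℕ} {h : List Bool} (hh : h.length = k.choose 2)
    (hne : avoiding k n h ≠ []) :
    Real.logb 2 (avoiding k n h).length ≤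
      n.choose 2 - ((n / k : ℕ) : ℝ) / 2 ^ k.choose 2 := by
  set M := (avoiding k n h).length
  set J := k.choose 2
  set N := n / k
  have hM : (0 : ℝ) < M := by exact_mod_cast List.length_pos_iff.2 hne
  have hQ : (0 : ℝ) < 2 ^ J := by positivity
  have hcount : (M : ℝ) * (2 ^ J) ^ N ≤ 2 ^ n.choose 2 * (2 ^ J - 1) ^ N := by
    have h1 := length_avoiding_mul_le k n hh
    have h2 : ((2 ^ J - 1 : ℕ) : ℝ) = 2 ^ J - 1 := by
      rw [Nat.cast_sub Nat.one_le_two_pow]; simp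
    have h3 : ((M * (2 ^ J) ^ N : ℕ) : ℝ) ≤ ((2 ^ n.choose 2 * (2 ^ J - 1) ^ N : ℕ) : ℝ) := by
      exact_mod_cast h1
    simpa [h2] using h3
  have hexp : (2 ^ J - 1 : ℝ) ≤ 2 ^ J * Real.exp (-1 / 2 ^ J) := by
    have h1 := Real.add_one_le_exp (-1 / 2 ^ J : ℝ)
    calc (2 ^ J - 1 : ℝ) = 2 ^ J * (-1 / 2 ^ J + 1) := by field_simp; ring
      _ ≤ _ := by gcongr
  have hJ : (0 : ℝ) ≤ 2 ^ J - 1 := sub_nonneg.2 (one_le_pow₀ one_le_two)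
  have hMle : (M : ℝ) ≤ 2 ^ n.choose 2 * Real.exp (-(N / 2 ^ J)) := by
    have h1 : (M : ℝ) * (2 ^ J) ^ N ≤ 2 ^ n.choose 2 * Real.exp (-(N / 2 ^ J)) * (2 ^ J) ^ N := by
      calc (M : ℝ) * (2 ^ J) ^ N ≤ 2 ^ n.choose 2 * (2 ^ J * Real.exp (-1 / 2 ^ J)) ^ N := by
            refine hcount.trans ?_
            gcongr
        _ = _ := by
            rw [mul_pow, ← Real.exp_nat_mul]
            ring_nf
    exact le_of_mul_le_mul_right h1 (by positivity)
  have hlog : Real.log M ≤ n.choose 2 * Real.log 2 - N / 2 ^ J := by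
    have h1 := Real.log_le_log hM hMle
    rw [Real.log_mul (by positivity) (by positivity), Real.log_pow, Real.log_exp] at h1
    linarith
  have hl2 : 0 < Real.log 2 := Real.log_pos one_lt_two
  have hl2' : Real.log 2 ≤ 1 := (Real.log_two_lt_d9.le).trans (by norm_num)
  rw [Real.logb, div_le_iff₀ hl2, sub_mul]
  have h2 : (N : ℝ) / 2 ^ J * Real.log 2 ≤ N / 2 ^ J := mul_le_of_le_one_right (by positivity) hl2'
  linarith

/-- In a `δ`-random graph not containing `H`, there cannot be many blocks. -/
theorem exists_blocks_le {U : Machine} (hU : IsUniversal U) :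
    ∃ c : ℕ, ∀ (δ : ℝ) (k n : ℕ) (G : SimpleGraph (Fin n)) (H : SimpleGraph (Fin k)),
      IsRandom U δ G → ¬ OccursIn H G →
        ((n / k : ℕ) : ℝ) / 2 ^ k.choose 2 ≤ δ + k + k.choose 2 + c := by
  obtain ⟨c, hc⟩ := exists_condComplexity_le hU
  -- One extra bit is the separator after the unary `k`, the other rounds the logarithm up.
  refine ⟨c + 2, fun δ k n G H hG hH => ?_⟩
  have hx : edgeString G ∈ avoiding k n (edgeString H) :=
    mem_avoiding.2 ⟨by rw [edgeString_length, pairs_length],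
      fun h => hH (occursIn_of_mem_blocks h)⟩
  have h1 := hc k n _ _ (edgeString_length H) hx
  have h2 := logb_length_avoiding_le (edgeString_length H) (List.ne_nil_of_mem hx)
  have hM : 1 ≤ (avoiding k n (edgeString H)).length := List.length_pos_of_mem hx
  have h3 : (Nat.clog 2 (avoiding k n (edgeString H)).length : ℝ) <
      Real.logb 2 (avoiding k n (edgeString H)).length + 1 := by
    rw [← Real.natCeil_logb_natCast, Nat.cast_ofNat]
    exact Nat.ceil_lt_add_one (Real.logb_nonneg one_lt_two (by exact_mod_cast hM))
  have h4 : (condComplexity U (edgeString G) n : ℝ) ≤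
      k + 1 + k.choose 2 + Nat.clog 2 (avoiding k n (edgeString H)).length + c := by
    exact_mod_cast h1
  have h5 : (n.choose 2 : ℝ) - δ ≤ _ := hG
  push_cast
  linarith

/-! ### Asymptotic estimates -/

/-- The number of expected blocks of `k` nodes inducing a given graph is large. -/
theorem blocks_ge {k n : ℕ} (hk : 1 ≤ k) {s : ℝ} (hks : (k : ℝ) ≤ s) (hsn : 2 * s ≤ n)
    (hs : (2 : ℝ) ^ (s ^ 2 / 2) = n) :
    (2 : ℝ) ^ (s / 2) / (2 * s) ≤ ((n / k : ℕ) : ℝ) / 2 ^ k.choose 2 := by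
  have hk' : (1 : ℝ) ≤ k := by exact_mod_cast hk
  have hn : (0 : ℝ) < n := by linarith
  -- Since `n / s ≥ 2`, the loss of 1 in the floor is at most half of `n / s`.
  have hN : (n : ℝ) / (2 * s) ≤ ((n / k : ℕ) : ℝ) := by
    have h1 : (n : ℝ) / k < ((n / k : ℕ) : ℝ) + 1 := by
      rw [← Nat.floor_div_eq_div (K := ℝ)]
      exact Nat.lt_floor_add_one _
    have h2 : (n : ℝ) / s ≤ n / k := by gcongr
    have h3 : 2 ≤ (n : ℝ) / s := by rwa [le_div_iff₀ (by linarith)]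
    have h4 : (n : ℝ) / (2 * s) = n / s / 2 := by field_simp
    linarith
  -- `k * (k - 1) / 2 ≤ s ^ 2 / 2 - s / 2`, as `1 ≤ k ≤ s`.
  have hJ : (2 : ℝ) ^ k.choose 2 ≤ n / 2 ^ (s / 2) := by
    rw [← hs, ← Real.rpow_sub two_pos, ← Real.rpow_natCast]
    refine Real.rpow_le_rpow_of_exponent_le one_le_two ?_
    rw [Nat.cast_choose_two]
    nlinarith
  calc (2 : ℝ) ^ (s / 2) / (2 * s) = n / (2 * s) / (n / 2 ^ (s / 2)) := by field_simp
    _ ≤ _ := by gcongr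

/-- The first term bounds `δ` and takes at most half of the right side once `s ≥ 2`; the polynomial
fits into the other half because `2 ^ (s / 2)` outgrows `s ^ 3`. -/
theorem eventually_overhead_lt (c : ℝ) :
    ∀ᶠ s : ℝ in Filter.atTop,
      (2 : ℝ) ^ (s / 2) / (2 * s ^ 2) + s + s ^ 2 + c ≤ (2 : ℝ) ^ (s / 2) / (2 * s) := by
  have hb : (0 : ℝ) < Real.log 2 / 2 := by
    have := Real.log_pos one_lt_two
    linarith
  have hlim := tendsto_exp_mul_div_rpow_atTop 3 _ hb
  filter_upwards [hlim.eventually_ge_atTop (4 * (2 + |c|)), Filter.eventually_ge_atTop (2 : ℝ)]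
    with s h1 h2
  have hexp : Real.exp (Real.log 2 / 2 * s) = (2 : ℝ) ^ (s / 2) := by
    rw [Real.rpow_def_of_pos two_pos]; ring_nf
  rw [hexp, le_div_iff₀ (by positivity)] at h1
  have h3 : s ^ (3 : ℝ) = s ^ 3 := by exact_mod_cast Real.rpow_natCast s 3
  rw [h3] at h1
  set E := (2 : ℝ) ^ (s / 2)
  have hE : 0 < E := by positivity
  have h4 : E / (2 * s ^ 2) ≤ E / (4 * s) := by
    exact div_le_div_of_nonneg_left hE.le (by positivity) (by nlinarith)
  have h5 : E / (2 * s) = E / (4 * s) + E / (4 * s) := by field_simp; norm_num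
  have h6 : (2 + |c|) * s ^ 2 ≤ E / (4 * s) := by
    rw [le_div_iff₀ (by positivity)]
    linarith
  have h7 : s + s ^ 2 + c ≤ (2 + |c|) * s ^ 2 := by
    have := le_abs_self c
    nlinarith [abs_nonneg c, mul_nonneg (abs_nonneg c) (by nlinarith : (0 : ℝ) ≤ s ^ 2 - 1)]
  linarith

theorem tendsto_sqrt_two_mul_logb :
    Filter.Tendsto (fun n : ℕ => Real.sqrt (2 * Real.logb 2 (n : ℝ))) Filter.atTop Filter.atTop :=
  Real.tendsto_sqrt_atTop.comp (((Real.tendsto_logb_atTop one_lt_two).comp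
    tendsto_natCast_atTop_atTop).const_mul_atTop two_pos)

end KolmogorovGraphs

open KolmogorovGraphs in
theorem theorem2 (U : KolmogorovGraphs.Machine) (hU : KolmogorovGraphs.IsUniversal U) :
    ∃ n₀ : ℕ, ∀ (δ : ℕ → ℝ) (n : ℕ), n₀ ≤ n →
      δ n < (2 : ℝ) ^ Real.sqrt (1 / 2 * Real.logb 2 (n : ℝ)) / (4 * Real.logb 2 (n : ℝ)) →
      ∀ G : SimpleGraph (Fin n), KolmogorovGraphs.IsRandom U (δ n) G →
        ∀ k : ℕ, (k : ℝ) ≤ Real.sqrt (2 * Real.logb 2 (n : ℝ)) →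
          ∀ H : SimpleGraph (Fin k), KolmogorovGraphs.OccursIn H G := by
  obtain ⟨c, hc⟩ := exists_blocks_le hU
  have hev := (tendsto_sqrt_two_mul_logb.eventually (eventually_overhead_lt c)).and
    ((tendsto_sqrt_two_mul_logb.eventually_ge_atTop 4).and (Filter.eventually_ge_atTop 1))
  obtain ⟨n₀, hn₀⟩ := Filter.eventually_atTop.1 hev
  refine ⟨n₀, fun δ n hn hδ G hG k hk H => ?_⟩
  obtain ⟨hover, hs4, hn1⟩ := hn₀ n hn
  by_contra hH
  -- The graph on no nodes occurs trivially.
  have hk1 : 1 ≤ k := by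
    by_contra hk0
    obtain rfl : k = 0 := by omega
    exact hH ⟨fun a => a.elim0, fun a => a.elim0, fun a => a.elim0⟩
  have hk1' : (1 : ℝ) ≤ k := by exact_mod_cast hk1
  set s := Real.sqrt (2 * Real.logb 2 (n : ℝ)) with hs
  have hnpos : (0 : ℝ) < n := by exact_mod_cast hn1
  have hlog : 0 ≤ Real.logb 2 (n : ℝ) := Real.logb_nonneg one_lt_two (by exact_mod_cast hn1)
  have hsq : s ^ 2 = 2 * Real.logb 2 (n : ℝ) := Real.sq_sqrt (by linarith)
  have hpow : (2 : ℝ) ^ (s ^ 2 / 2) = n := by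
    rw [hsq, mul_div_cancel_left₀ _ two_ne_zero]
    exact Real.rpow_logb two_pos (by norm_num) hnpos
  have hhalf : Real.sqrt (1 / 2 * Real.logb 2 (n : ℝ)) = s / 2 := by
    rw [Real.sqrt_eq_iff_mul_self_eq (by linarith) (by linarith)]
    nlinarith
  have hsn : 2 * s ≤ n := by
    have h1 : (2 : ℝ) ^ (2 * s) ≤ n := by
      rw [← hpow]
      exact Real.rpow_le_rpow_of_exponent_le one_le_two (by nlinarith)
    -- Bernoulli: `1 + 2 * s ≤ 2 ^ (2 * s)`.
    have h2 := one_add_mul_self_le_rpow_one_add (s := 1) (p := 2 * s) (by norm_num) (by linarith)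
    norm_num at h2
    linarith
  have hblocks := (blocks_ge hk1 hk hsn hpow).trans (hc (δ n) k n G H hG hH)
  have hchoose : (k.choose 2 : ℝ) ≤ s ^ 2 := by
    rw [Nat.cast_choose_two]
    nlinarith
  rw [hhalf, show 4 * Real.logb 2 (n : ℝ) = 2 * s ^ 2 by rw [hsq]; ring] at hδ
  linarith
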